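/- In the block-aware caching problem with eviction cost there are a cache of size $k$ and $n$ pages, partitioned into a set $\mathcal B$ of blocks with at most $\beta$ pages each, where $1\le\beta\le k$; block $B$ has a cost $c_B>0$. The cache is initially empty. At each time step a page is requested, and after that time step the requested page must be in the cache, which may never hold more than $k$ pages. Fetching pages is free; evicting any non-empty set of pages of a block $B$ in one time step costs $c_B$. Let $\Delta=\max_B c_B/\min_B c_B$. For a finite request sequence $\sigma$ let $\mathrm{OPT}(\sigma)$ be the minimum total eviction cost of a feasible offline cache policy for $\sigma$. A randomized online algorithm chooses the contents of the cache after each time step as a function of its random bits and of the requests made up to that time step; it may know the pages, the blocks, their costs and $k$ in advance, but neither the future requests nor the length of $\sigma$, and its cache policy is feasible for all outcomes of its random bits. There is an absolute constant $K>0$ such that for all pages, blocks and costs as above and all $k\ge 2$ there is a randomized online algorithm $A$ with $$\mathbb E[\mathrm{cost}(A,\sigma)]\;\le\;K\cdot\log k\cdot\log(k\Delta)\cdot\mathrm{OPT}(\sigma)+\sum_{B\in\mathcal B}c_B$$ for every request sequence $\sigma$ (fixed independently of the random bits). In particular, if all block costs are equal, then $\mathbb E[\mathrm{cost}(A,\sigma)]\le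 K\cdot\log^2 k\cdot\mathrm{OPT}(\sigma)+\sum_{B}c_B$ for every $\sigma$. -/

import Mathlib

/-- An instance of weighted block-aware caching, without its request sequence: a finite set of
pages partitioned into blocks (the fibres of the surjection `block`), block costs `c_B > 0`, a
cache size `k`, and a bound `β ∈ {1, …, k}` on the number of pages in a block. -/
structure BlockCaching (Page Block : Type) [Fintype Page] [DecidableEq Block] where
  /-- the size of the cache -/
  k : ℕ
  /-- the bound on the size of the blocks -/
  β : ℕ
  one_le_β : 1 ≤ β
  β_le_k : β ≤ k
  /-- the block that contains a page -/
  block : Page → Block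
  block_surjective : Function.Surjective block
  card_block_le : ∀ B, (Finset.univ.filter (fun p => block p = B)).card ≤ β
  /-- the cost `c_B` of a block -/
  c : Block → ℝ
  c_pos : ∀ B, 0 < c B

namespace BlockCaching

variable {Page Block : Type} [Fintype Page] [DecidableEq Page] [Fintype Block] [DecidableEq Block]

/-- The aspect ratio `Δ = c_max / c_min`. -/
noncomputable def aspectRatio (I : BlockCaching Page Block) : ℝ :=
  (⨆ B, I.c B) / (⨅ B, I.c B)

/-- The eviction cost of a time step that changes the cache from `X` to `Y`: the block `B` costs
`c_B` if at least one page of `B` is evicted, however many they are. Fetching is free. -/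
noncomputable def stepCost (I : BlockCaching Page Block) (X Y : Finset Page) : ℝ :=
  ∑ B ∈ (X \ Y).image I.block, I.c B

/-- `C t` is the cache after time step `t`. The cache is initially empty; it never holds more than
`k` pages; and the page requested at time step `t + 1`, which is `σ[t]`, is in the cache after
that time step. -/
structure IsFeasible (I : BlockCaching Page Block) (σ : List Page) (C : ℕ → Finset Page) :
    Prop where
  init : C 0 = ∅
  card_le : ∀ t, t ≤ σ.length → (C t).card ≤ I.k
  serves : ∀ (t : ℕ) (ht : t < σ.length), σ[t] ∈ C (t + 1)

/-- The total eviction cost of a cache policy on the request sequence `σ`. -/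
noncomputable def cost (I : BlockCaching Page Block) (σ : List Page) (C : ℕ → Finset Page) : ℝ :=
  ∑ t ∈ Finset.range σ.length, I.stepCost (C t) (C (t + 1))

/-- The optimal offline eviction cost of `σ`. -/
noncomputable def opt (I : BlockCaching Page Block) (σ : List Page) : ℝ :=
  sInf {x | ∃ C : ℕ → Finset Page, I.IsFeasible σ C ∧ I.cost σ C = x}

/-- A randomized (integral) online algorithm: for every outcome `ω` of its random bits, the cache
after a time step is a function `cache ω h` of the list `h` of the requests made so far, in the
order of their arrival. The length of the request sequence and the future requests are unknown to
it, and the requests do not depend on `ω` (oblivious adversary). -/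
structure RandomizedOnlineAlgorithm (I : BlockCaching Page Block) where
  Ω : Type
  [measurableSpace : MeasurableSpace Ω]
  μ : MeasureTheory.Measure Ω
  [isProbabilityMeasure : MeasureTheory.IsProbabilityMeasure μ]
  cache : Ω → List Page → Finset Page
  measurableSet_cache : ∀ h X, MeasurableSet {ω | cache ω h = X}
  cache_nil : ∀ ω, cache ω [] = ∅
  card_cache_le : ∀ ω h, (cache ω h).card ≤ I.k
  mem_cache : ∀ ω h p, p ∈ cache ω (h ++ [p])

namespace RandomizedOnlineAlgorithm

variable {I : BlockCaching Page Block}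

/-- The expected eviction cost of the algorithm on the request sequence `σ`. -/
noncomputable def expectedCost (A : I.RandomizedOnlineAlgorithm) (σ : List Page) : ℝ :=
  letI := A.measurableSpace
  ∫ ω, I.cost σ (fun t => A.cache ω (σ.take t)) ∂A.μ

/-- The algorithm is `r`-competitive with additive constant `b`. -/
def IsCompetitive (A : I.RandomizedOnlineAlgorithm) (r b : ℝ) : Prop :=
  ∀ σ : List Page, A.expectedCost σ ≤ r * I.opt σ + b

end RandomizedOnlineAlgorithm

end BlockCaching

set_option linter.unusedSectionVars false

/-! An online fractional solution is kept in units of `1 / M`. A page of age `a` counts as evicted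
to the extent `min M a`, and flushing a block ages all its pages except the requested one. Each
state satisfies a knapsack cover inequality (`serve_saturated`): with block contributions truncated
at the deficit, it demands `α` times the necessary eviction.

For the fractional cost, let `w B` be the amount by which `B` was flushed since an offline policy
last evicted from it. Pages missing from the offline cache have age at least `min (w B) M`, and at
least as many young pages are missing as the deficit. Hence every round of flushing is paid for by a
drop of a potential logarithmic in `w` (`Dominates.relax`), which an offline eviction from `B`
raises by at most `O(log k)` times `c B`. So the fractional cost is `O(α log k)` times the offline
cost (`level_cost_le`).

For the rounding, each block gets one uniform offset and is flushed whenever its level plus offset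
passes a multiple of `M`. The expected flushing cost equals the fractional cost (`sum_add_div`). The
offsets are independent, so a Chernoff bound shows that the retained pages overflow with probability
at most `exp (1 - α / 2)` (`card_overflow_le`); then only the fresh pages are kept, at cost at most
`k` times the largest block cost. Such failures are charged only at requests to pages that are not
fresh, whose number is bounded by a balance of evicted mass (`activeSteps_le`). Since `M` is
polynomial in `k Δ`, some `α` of order `log (k Δ)` absorbs them (`expectedCost_le`). -/

namespace BlockCaching

variable {Page Block : Type} [Fintype Page] [DecidableEq Page] [Fintype Block] [DecidableEq Block]

/-! ### The fractional algorithm and its rounding -/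

/-- The state of the fractional algorithm, in units of `1 / M`: `level B` is the total amount of
flushing of the block `B`, and `age q` is the amount of flushing of the block of `q` since the last
request to `q`. -/
structure FlushState (Page Block : Type) where
  level : Block → ℕ
  age : Page → ℕ

namespace FlushState

/-- The pages that are not yet completely evicted. -/
def young (M : ℕ) (s : FlushState Page Block) : Finset Page :=
  Finset.univ.filter fun q => s.age q < M

/-- The pages of which no part is evicted. -/
def fresh (s : FlushState Page Block) : Finset Page :=
  Finset.univ.filter fun q => s.age q = 0

/-- The total evicted amount. -/
def mass (M : ℕ) (s : FlushState Page Block) : ℕ :=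
  ∑ q, min M (s.age q)

end FlushState

open FlushState

variable (I : BlockCaching Page Block) (M α : ℕ)

/-- The number of young pages that have to be evicted. -/
def deficit (s : FlushState Page Block) : ℕ := (s.young M).card - I.k

/-- The number of young pages of `B` whose age is more than `j`. -/
def covered (s : FlushState Page Block) (B : Block) (j : ℕ) : ℕ :=
  ((s.young M).filter fun q => I.block q = B ∧ j < s.age q).card

/-- The contribution of `B` to the knapsack cover inequality. -/
def coverage (s : FlushState Page Block) (B : Block) : ℕ :=
  ∑ j ∈ Finset.range M, min (I.deficit M s) (I.covered M s B j)

/-- The knapsack cover inequality, scaled by `α`. -/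
def Saturated (s : FlushState Page Block) : Prop :=
  α * M * I.deficit M s ≤ ∑ B, I.coverage M s B

/-- The number of young pages of `B`. -/
def youngCard (s : FlushState Page Block) (B : Block) : ℕ :=
  ((s.young M).filter fun q => I.block q = B).card

/-- The additive term in the multiplicative update. -/
noncomputable def shift : ℝ := α * M / I.k

/-- The amount by which `B` is flushed in one round of the fractional algorithm. -/
noncomputable def increment (s : FlushState Page Block) (B : Block) : ℕ :=
  ⌈(⨆ B', I.c B') / I.c B * (I.coverage M s B / I.shift M α + I.youngCard M s B)⌉₊

/-- One round of flushing while the page `p` is requested. -/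
noncomputable def bump (p : Page) (s : FlushState Page Block) : FlushState Page Block where
  level B := s.level B + I.increment M α s B
  age q := if q = p then 0 else s.age q + I.increment M α s (I.block q)

open Classical in
/-- One round of flushing, if it is needed. -/
noncomputable def relax (p : Page) (s : FlushState Page Block) : FlushState Page Block :=
  if I.Saturated M α s then s else I.bump M α p s

/-- The state after a request to `p`. -/
noncomputable def serve (s : FlushState Page Block) (p : Page) : FlushState Page Block :=
  (I.relax M α p)^[M] ⟨s.level, Function.update s.age p 0⟩

/-- The state before the first request. -/
def initialState : FlushState Page Block := ⟨fun _ => 0, fun _ => M⟩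

/-- The state after the requests `h`. -/
noncomputable def stateAfter (h : List Page) : FlushState Page Block :=
  h.foldl (I.serve M α) (initialState M)

/-- The pages whose block has not been flushed since their last request, where the block `B` is
flushed whenever `level B + θ B` passes a multiple of `M`. -/
def retained (s : FlushState Page Block) (θ : Block → Fin M) : Finset Page :=
  Finset.univ.filter fun q => s.age q ≤ (s.level (I.block q) + θ (I.block q)) % M

/-- The contents of the cache: the retained pages if they fit, and the fresh pages otherwise. -/
def cacheOf (s : FlushState Page Block) (θ : Block → Fin M) : Finset Page :=
  if (I.retained M s θ).card ≤ I.k then I.retained M s θ else s.fresh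

variable {I M α}

/-! ### Consequences of the knapsack cover inequality -/

theorem sum_youngCard (s : FlushState Page Block) :
    ∑ B, I.youngCard M s B = (s.young M).card :=
  (Finset.card_eq_sum_card_fiberwise (fun _ _ => Finset.mem_coe.2 (Finset.mem_univ _))).symm

theorem sum_covered (s : FlushState Page Block) (B : Block) :
    ∑ j ∈ Finset.range M, I.covered M s B j
      = ∑ q ∈ (s.young M).filter (fun q => I.block q = B), s.age q := by
  simp only [covered, ← Finset.filter_filter, Finset.card_filter _ (Finset.filter _ _)]
  rw [Finset.sum_comm]
  refine Finset.sum_congr rfl fun q hq => ?_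
  have hq' : s.age q < M := by
    have := (Finset.mem_filter.1 (Finset.mem_filter.1 hq).1).2
    exact this
  rw [← Finset.card_filter]
  have : (Finset.range M).filter (fun j => j < s.age q) = Finset.range (s.age q) := by
    ext j; simp; omega
  rw [this, Finset.card_range]

theorem sum_coverage_le (s : FlushState Page Block) :
    ∑ B, I.coverage M s B ≤ ∑ q ∈ s.young M, s.age q := by
  calc ∑ B, I.coverage M s B
      ≤ ∑ B, ∑ q ∈ (s.young M).filter (fun q => I.block q = B), s.age q := by
        refine Finset.sum_le_sum fun B _ => ?_
        rw [← sum_covered]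
        exact Finset.sum_le_sum fun j _ => min_le_right _ _
    _ = ∑ q ∈ s.young M, s.age q := Finset.sum_fiberwise _ _ _

/-- Dropping the truncation and the factor `α` leaves ordinary fractional feasibility. -/
theorem Saturated.deficit_le (hα : 1 ≤ α) {s : FlushState Page Block} (h : I.Saturated M α s) :
    M * I.deficit M s ≤ ∑ q ∈ s.young M, s.age q := by
  refine le_trans ?_ (h.trans (sum_coverage_le s))
  rw [mul_assoc]
  exact Nat.le_mul_of_pos_left _ hα

/-- Fresh pages supply no evicted mass and other young pages less than `M` each, so at least the
deficit of young pages are not fresh. This makes the fallback cache feasible. -/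
theorem Saturated.card_fresh_le (hM : 0 < M) (hα : 1 ≤ α) {s : FlushState Page Block}
    (h : I.Saturated M α s) : s.fresh.card ≤ I.k := by
  have h1 := h.deficit_le hα
  have hsub : s.fresh ⊆ s.young M := by
    intro q; simp only [fresh, young, Finset.mem_filter, Finset.mem_univ, true_and]; omega
  have h2 : ∑ q ∈ s.young M, s.age q ≤ M * ((s.young M).card - s.fresh.card) := by
    rw [← Finset.card_sdiff_of_subset hsub, ← Finset.sum_sdiff hsub,
      Finset.sum_eq_zero (s := s.fresh) (fun q hq => (Finset.mem_filter.1 hq).2), add_zero,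
      mul_comm]
    refine Finset.sum_le_card_nsmul _ _ _ fun q hq => ?_
    exact (Finset.mem_filter.1 (Finset.mem_sdiff.1 hq).1).2.le
  have h3 := Nat.le_of_mul_le_mul_left (h1.trans h2) hM
  have h4 := Finset.card_le_card hsub
  unfold deficit at h3
  omega

theorem Saturated.le_mass (hα : 1 ≤ α) {s : FlushState Page Block}
    (h : I.Saturated M α s) : Fintype.card Page * M ≤ s.mass M + I.k * M := by
  have h1 := h.deficit_le hα
  have h2 : s.mass M = ∑ q ∈ s.young M, s.age q + (Fintype.card Page - (s.young M).card) * M := by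
    rw [mass, ← Finset.sum_filter_add_sum_filter_not Finset.univ (fun q => s.age q < M)]
    congr 1
    · exact Finset.sum_congr rfl fun q hq => min_eq_right (Finset.mem_filter.1 hq).2.le
    · rw [Finset.sum_congr rfl (g := fun _ => M) fun q hq =>
        min_eq_left (not_lt.1 (Finset.mem_filter.1 hq).2), Finset.sum_const, smul_eq_mul,
        Finset.filter_not, Finset.card_sdiff_of_subset (Finset.filter_subset _ _),
        Finset.card_univ, young]
  have h3 : (s.young M).card ≤ Fintype.card Page := Finset.card_le_univ _
  have h4 : Fintype.card Page ≤ I.deficit M s + (Fintype.card Page - (s.young M).card) + I.k := by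
    unfold deficit; omega
  calc Fintype.card Page * M
      ≤ (I.deficit M s + (Fintype.card Page - (s.young M).card) + I.k) * M :=
        Nat.mul_le_mul_right _ h4
    _ = M * I.deficit M s + (Fintype.card Page - (s.young M).card) * M + I.k * M := by ring
    _ ≤ s.mass M + I.k * M := by omega

/-! ### Rounds of flushing: monotonicity and termination -/

theorem level_le_relax (p : Page) (s : FlushState Page Block) (B : Block) :
    s.level B ≤ (I.relax M α p s).level B := by
  unfold relax bump; split_ifs <;> simp

theorem age_relax_le (p : Page) (s : FlushState Page Block) (q : Page) :
    (I.relax M α p s).age q + s.level (I.block q)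
      ≤ s.age q + (I.relax M α p s).level (I.block q) := by
  unfold relax bump
  split_ifs
  · simp
  · dsimp only; split_ifs <;> omega

theorem age_relax_self {p : Page} {s : FlushState Page Block} (hs : s.age p = 0) :
    (I.relax M α p s).age p = 0 := by
  unfold relax bump; split_ifs <;> simp [hs]

theorem saturated_of_young (hk : 1 ≤ I.k) {p : Page} {s : FlushState Page Block}
    (h : ∀ q, q ≠ p → M ≤ s.age q) : I.Saturated M α s := by
  have h1 : s.young M ⊆ {p} := by
    intro q hq
    by_contra hqp
    have := (Finset.mem_filter.1 hq).2
    have := h q (by simpa using hqp)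
    omega
  have h2 := Finset.card_le_card h1
  have h3 : I.deficit M s = 0 := by unfold deficit; simp at h2; omega
  simp [Saturated, h3]

theorem iSup_c_pos [Nonempty Block] : 0 < ⨆ B, I.c B :=
  (I.c_pos (Classical.arbitrary Block)).trans_le
    (le_ciSup (Set.finite_range I.c).bddAbove _)

theorem c_le_iSup (B : Block) : I.c B ≤ ⨆ B', I.c B' :=
  le_ciSup (Set.finite_range I.c).bddAbove B

theorem youngCard_le_increment (s : FlushState Page Block) (B : Block) :
    I.youngCard M s B ≤ I.increment M α s B := by
  have hc := c_le_iSup (I := I) B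
  have h1 : (1 : ℝ) ≤ (⨆ B', I.c B') / I.c B := (one_le_div (I.c_pos B)).2 hc
  have h2 : (0 : ℝ) ≤ I.coverage M s B / I.shift M α := by unfold shift; positivity
  have h3 : (I.youngCard M s B : ℝ) ≤ I.increment M α s B := by
    refine le_trans ?_ (Nat.le_ceil _)
    have h4 : (0 : ℝ) ≤ I.youngCard M s B := by positivity
    nlinarith
  exact_mod_cast h3

/-- The summand `youngCard` of the increment ages every young page other than `p` by at least one
unit per unsaturated round. After `M` such rounds only `p` can be young, and the deficit is zero. -/
theorem relax_iterate_saturated (hk : 1 ≤ I.k) (p : Page) (s : FlushState Page Block) :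
    I.Saturated M α ((I.relax M α p)^[M] s) := by
  by_contra hns
  have key : ∀ m, ¬ I.Saturated M α ((I.relax M α p)^[m] s) →
      ∀ q, q ≠ p → min m M ≤ ((I.relax M α p)^[m] s).age q := by
    intro m
    induction m with
    | zero => simp
    | succ m ih =>
      rw [Function.iterate_succ_apply']
      intro h q hq
      by_cases hm : I.Saturated M α ((I.relax M α p)^[m] s)
      · exact absurd (by simp [relax, hm]) h
      · have := ih hm q hq
        simp only [relax, hm, if_false, bump, hq]
        rcases lt_or_ge (((I.relax M α p)^[m] s).age q) M with hlt | hge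
        · have h1 : 1 ≤ I.youngCard M ((I.relax M α p)^[m] s) (I.block q) :=
            Finset.card_pos.2 ⟨q, by simp [young, hlt]⟩
          have h2 := youngCard_le_increment (I := I) (M := M) (α := α)
            ((I.relax M α p)^[m] s) (I.block q)
          omega
        · omega
  exact hns (saturated_of_young hk fun q hq => (min_self M).symm.trans_le (key M hns q hq))

theorem serve_saturated (hk : 1 ≤ I.k) (s : FlushState Page Block) (p : Page) :
    I.Saturated M α (I.serve M α s p) :=
  relax_iterate_saturated hk _ _

theorem serve_induction {s : FlushState Page Block} {p : Page}
    (P : FlushState Page Block → Prop) (h0 : P ⟨s.level, Function.update s.age p 0⟩)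
    (h : ∀ s', P s' → P (I.relax M α p s')) : P (I.serve M α s p) := by
  have key : ∀ n, P ((I.relax M α p)^[n] ⟨s.level, Function.update s.age p 0⟩) := by
    intro n
    induction n with
    | zero => exact h0
    | succ n ih =>
      rw [Function.iterate_succ_apply']
      exact h _ ih
  exact key M

theorem age_serve_self (s : FlushState Page Block) (p : Page) : (I.serve M α s p).age p = 0 :=
  serve_induction (fun s => s.age p = 0) (by simp) fun _ h => age_relax_self h

theorem level_le_serve (s : FlushState Page Block) (p : Page) (B : Block) :
    s.level B ≤ (I.serve M α s p).level B :=
  serve_induction (fun s' => s.level B ≤ s'.level B) le_rfl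
    fun s' h => h.trans (level_le_relax p s' B)

theorem age_serve_le (s : FlushState Page Block) (p q : Page) :
    (I.serve M α s p).age q + s.level (I.block q)
      ≤ s.age q + (I.serve M α s p).level (I.block q) := by
  refine serve_induction
    (fun s' => s'.age q + s.level (I.block q) ≤ s.age q + s'.level (I.block q)) ?_ fun s' h => ?_
  · simp only [Function.update_apply]; split_ifs <;> omega
  · have := age_relax_le (I := I) (M := M) (α := α) p s' q
    have := level_le_relax (I := I) (M := M) (α := α) p s' (I.block q)
    omega

theorem serve_eq_self {s : FlushState Page Block} (hs : I.Saturated M α s) {p : Page}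
    (hp : s.age p = 0) : I.serve M α s p = s := by
  have h : (⟨s.level, Function.update s.age p 0⟩ : FlushState Page Block) = s := by
    rw [← hp, Function.update_eq_self]
  rw [serve, h]
  exact Function.iterate_fixed (by simp [relax, hs]) M

theorem stateAfter_append (h : List Page) (p : Page) :
    I.stateAfter M α (h ++ [p]) = I.serve M α (I.stateAfter M α h) p := by
  simp [stateAfter]

theorem stateAfter_saturated (hk : 1 ≤ I.k) (h : List Page) :
    I.Saturated M α (I.stateAfter M α h) := by
  rcases List.eq_nil_or_concat h with rfl | ⟨l, p, rfl⟩
  · have : (initialState M : FlushState Page Block).young M = ∅ := by simp [young, initialState]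
    simp [stateAfter, Saturated, deficit, this]
  · rw [List.concat_eq_append, stateAfter_append]
    exact serve_saturated hk _ _

/-! ### The rounded cache and the cost of one step -/

theorem fresh_subset_retained (s : FlushState Page Block) (θ : Block → Fin M) :
    s.fresh ⊆ I.retained M s θ := by
  intro q
  simp only [fresh, retained, Finset.mem_filter, Finset.mem_univ, true_and]
  omega

theorem fresh_subset_cacheOf (s : FlushState Page Block) (θ : Block → Fin M) :
    s.fresh ⊆ I.cacheOf M s θ := by
  unfold cacheOf; split_ifs
  · exact fresh_subset_retained s θ
  · exact subset_rfl

theorem cacheOf_subset_retained (s : FlushState Page Block) (θ : Block → Fin M) :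
    I.cacheOf M s θ ⊆ I.retained M s θ := by
  unfold cacheOf; split_ifs
  · exact subset_rfl
  · exact fresh_subset_retained s θ

theorem card_cacheOf_le (hM : 0 < M) (hα : 1 ≤ α) {s : FlushState Page Block}
    (hs : I.Saturated M α s) (θ : Block → Fin M) : (I.cacheOf M s θ).card ≤ I.k := by
  unfold cacheOf; split_ifs with h
  · exact h
  · exact hs.card_fresh_le hM hα

theorem retained_initialState (hM : 0 < M) (θ : Block → Fin M) :
    I.retained M (initialState M) θ = ∅ := by
  refine Finset.filter_eq_empty_iff.2 fun q _ => ?_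
  simp only [initialState, not_le]
  exact Nat.mod_lt _ hM

/-- A page is retained as long as the level of its block does not pass a multiple of `M`. -/
theorem le_mod_of_div_eq {a a' l l' t : ℕ} (hl : l ≤ l') (ha : a' + l ≤ a + l')
    (h : a ≤ (l + t) % M) (hd : (l' + t) / M ≤ (l + t) / M) : a' ≤ (l' + t) % M := by
  have hd' : (l' + t) / M = (l + t) / M :=
    le_antisymm hd (Nat.div_le_div_right (by omega))
  have h1 := Nat.div_add_mod (l + t) M
  have h2 := Nat.div_add_mod (l' + t) M
  rw [hd'] at h2
  omega

theorem stepCost_le_of_subset {X Y : Finset Page} {Z : Finset Block}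
    (h : ∀ q ∈ X, q ∉ Y → I.block q ∈ Z) : I.stepCost X Y ≤ ∑ B ∈ Z, I.c B := by
  refine Finset.sum_le_sum_of_subset_of_nonneg ?_ fun B _ _ => (I.c_pos B).le
  intro B hB
  obtain ⟨q, hq, rfl⟩ := Finset.mem_image.1 hB
  rw [Finset.mem_sdiff] at hq
  exact h q hq.1 hq.2

theorem stepCost_le_card (X Y : Finset Page) :
    I.stepCost X Y ≤ X.card * ⨆ B, I.c B := by
  have hnn : 0 ≤ ⨆ B, I.c B := Real.iSup_nonneg fun B => (I.c_pos B).le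
  calc I.stepCost X Y ≤ ∑ _B ∈ (X \ Y).image I.block, ⨆ B, I.c B :=
        Finset.sum_le_sum fun B _ => c_le_iSup B
    _ = ((X \ Y).image I.block).card * ⨆ B, I.c B := by simp
    _ ≤ _ := by
        refine mul_le_mul_of_nonneg_right ?_ hnn
        exact_mod_cast Finset.card_image_le.trans (Finset.card_le_card Finset.sdiff_subset)

/-- The number of times that `B` has been flushed. -/
def flushes (s : FlushState Page Block) (θ : Block → Fin M) (B : Block) : ℕ :=
  (s.level B + θ B) / M

-- A request to a fresh page changes nothing. Otherwise, if the new retained pages fit, every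
-- eviction is due to a flush, even after an overflow, since the fallback is contained in the
-- retained pages. Only a step that ends in an overflow is charged for the whole cache.
open Classical in
theorem stepCost_serve_le (hM : 0 < M) (hα : 1 ≤ α) {s : FlushState Page Block}
    (hs : I.Saturated M α s) (p : Page) (θ : Block → Fin M) :
    I.stepCost (I.cacheOf M s θ) (I.cacheOf M (I.serve M α s p) θ)
      ≤ ∑ B, I.c B * ((flushes (I.serve M α s p) θ B : ℝ) - flushes s θ B)
        + (if s.age p ≠ 0 then
            if I.k < (I.retained M (I.serve M α s p) θ).card then I.k * ⨆ B, I.c B else 0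
          else 0) := by
  have hmono : ∀ B, flushes s θ B ≤ flushes (I.serve M α s p) θ B := fun B =>
    Nat.div_le_div_right (Nat.add_le_add_right (level_le_serve s p B) _)
  have hnn : 0 ≤ ∑ B, I.c B * ((flushes (I.serve M α s p) θ B : ℝ) - flushes s θ B) :=
    Finset.sum_nonneg fun B _ => mul_nonneg (I.c_pos B).le
      (sub_nonneg.2 (by exact_mod_cast hmono B))
  have hsup : 0 ≤ ⨆ B, I.c B := Real.iSup_nonneg fun B => (I.c_pos B).le
  by_cases hp : s.age p = 0
  · rw [serve_eq_self hs hp]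
    simp [stepCost, hp]
  rw [if_pos hp]
  split_ifs with hfail
  · refine le_trans ?_ (le_add_of_nonneg_left hnn)
    refine (stepCost_le_card _ _).trans (mul_le_mul_of_nonneg_right ?_ hsup)
    exact_mod_cast card_cacheOf_le hM hα hs θ
  · rw [add_zero]
    have hc : I.cacheOf M (I.serve M α s p) θ = I.retained M (I.serve M α s p) θ :=
      if_pos (not_lt.1 hfail)
    rw [hc]
    calc I.stepCost (I.cacheOf M s θ) (I.retained M (I.serve M α s p) θ)
        ≤ ∑ B ∈ Finset.univ.filter
            (fun B => flushes s θ B < flushes (I.serve M α s p) θ B), I.c B := by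
          refine stepCost_le_of_subset fun q hq hq' => ?_
          have hq := cacheOf_subset_retained s θ hq
          simp only [retained, Finset.mem_filter, Finset.mem_univ, true_and] at hq hq' ⊢
          by_contra hlt
          exact hq' (le_mod_of_div_eq (level_le_serve s p _) (age_serve_le s p q) hq
            (not_lt.1 hlt))
      _ ≤ ∑ B, I.c B * ((flushes (I.serve M α s p) θ B : ℝ) - flushes s θ B) := by
          rw [Finset.sum_filter]
          refine Finset.sum_le_sum fun B _ => ?_
          have h1 : (flushes s θ B : ℝ) ≤ flushes (I.serve M α s p) θ B := by
            exact_mod_cast hmono B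
          have h2 := I.c_pos B
          split_ifs with h
          · have h3 : (flushes s θ B : ℝ) + 1 ≤ flushes (I.serve M α s p) θ B := by
              exact_mod_cast h
            nlinarith
          · exact mul_nonneg h2.le (sub_nonneg.2 h1)

/-! ### The number of requests to pages that are not fresh -/

/-- A block has at most `β ≤ k` pages, so a unit of flushing creates at most `k` units of evicted
mass. -/
theorem mass_add_le {s s' : FlushState Page Block} (hl : ∀ B, s.level B ≤ s'.level B)
    (ha : ∀ q, s'.age q + s.level (I.block q) ≤ s.age q + s'.level (I.block q)) :
    s'.mass M + I.k * ∑ B, s.level B ≤ s.mass M + I.k * ∑ B, s'.level B := by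
  have h1 : s'.mass M ≤ s.mass M + ∑ q, (s'.level (I.block q) - s.level (I.block q)) := by
    rw [mass, mass, ← Finset.sum_add_distrib]
    refine Finset.sum_le_sum fun q _ => ?_
    have := ha q
    have := hl (I.block q)
    omega
  have h2 : ∑ q, (s'.level (I.block q) - s.level (I.block q))
      ≤ ∑ B, I.k * (s'.level B - s.level B) := by
    rw [← Finset.sum_fiberwise Finset.univ I.block]
    refine Finset.sum_le_sum fun B _ => ?_
    rw [Finset.sum_congr rfl (g := fun _ => s'.level B - s.level B)
      fun q hq => by rw [(Finset.mem_filter.1 hq).2], Finset.sum_const, smul_eq_mul]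
    exact Nat.mul_le_mul_right _ ((I.card_block_le B).trans I.β_le_k)
  have h3 : ∑ B, I.k * (s'.level B - s.level B) + I.k * ∑ B, s.level B
      = I.k * ∑ B, s'.level B := by
    rw [Finset.mul_sum, Finset.mul_sum, ← Finset.sum_add_distrib]
    refine Finset.sum_congr rfl fun B _ => ?_
    rw [← mul_add, Nat.sub_add_cancel (hl B)]
  omega

theorem mass_update {s : FlushState Page Block} (hM : 0 < M) {p : Page} (hp : s.age p ≠ 0) :
    (⟨s.level, Function.update s.age p 0⟩ : FlushState Page Block).mass M + 1 ≤ s.mass M := by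
  unfold mass
  rw [Nat.succ_le_iff]
  refine Finset.sum_lt_sum (fun q _ => ?_) ⟨p, Finset.mem_univ p, ?_⟩
  · simp only [Function.update_apply]; split_ifs <;> simp
  · simp; omega

theorem mass_serve_le (hM : 0 < M) (s : FlushState Page Block) (p : Page) :
    (if s.age p ≠ 0 then 1 else 0) + (I.serve M α s p).mass M + I.k * ∑ B, s.level B
      ≤ s.mass M + I.k * ∑ B, (I.serve M α s p).level B := by
  refine serve_induction (fun s' => (if s.age p ≠ 0 then 1 else 0) + s'.mass M
    + I.k * ∑ B, s.level B ≤ s.mass M + I.k * ∑ B, s'.level B) ?_ fun s' h => ?_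
  · split_ifs with hp
    · have := mass_update (M := M) hM hp
      dsimp only
      omega
    · have : (⟨s.level, Function.update s.age p 0⟩ : FlushState Page Block) = s := by
        rw [← not_not.1 hp, Function.update_eq_self]
      rw [this]
      omega
  · have := mass_add_le (I := I) (M := M) (fun B => level_le_relax (I := I) (M := M) (α := α) p s' B)
      (age_relax_le p s')
    omega

/-- The number of time steps with a request to a page that is not fresh. -/
noncomputable def activeSteps (I : BlockCaching Page Block) (M α : ℕ) (σ : List Page) : ℕ :=
  ∑ t : Fin σ.length, if (I.stateAfter M α (σ.take t)).age σ[t] ≠ 0 then 1 else 0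

theorem sum_fin_le_of_step {σ : List Page} (f : Fin σ.length → ℝ) (Φ : ℕ → ℝ)
    (h : ∀ t : Fin σ.length, f t ≤ Φ (t + 1) - Φ t) : ∑ t, f t ≤ Φ σ.length - Φ 0 := by
  calc ∑ t, f t ≤ ∑ t : Fin σ.length, (Φ (t + 1) - Φ t) := Finset.sum_le_sum fun t _ => h t
    _ = ∑ t ∈ Finset.range σ.length, (Φ (t + 1) - Φ t) :=
        Fin.sum_univ_eq_sum_range (fun t => Φ (t + 1) - Φ t) _
    _ = _ := Finset.sum_range_sub _ _

theorem stateAfter_take_succ (σ : List Page) (t : ℕ) (ht : t < σ.length) :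
    I.stateAfter M α (σ.take (t + 1)) = I.serve M α (I.stateAfter M α (σ.take t)) σ[t] := by
  rw [← List.take_append_getElem ht, stateAfter_append]

/-- Each active request destroys at least one unit of evicted mass. The mass starts at `M` per page
and ends at most `k * M` lower, so all further destruction is matched by flushing. -/
theorem activeSteps_le (hM : 0 < M) (hα : 1 ≤ α) (hk : 1 ≤ I.k) (σ : List Page) :
    I.activeSteps M α σ ≤ I.k * M + I.k * ∑ B, (I.stateAfter M α σ).level B := by
  have h1 : ((I.activeSteps M α σ : ℕ) : ℝ)
      ≤ ((I.k * ∑ B, (I.stateAfter M α (σ.take σ.length)).level B : ℕ)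
          - ((I.stateAfter M α (σ.take σ.length)).mass M : ℝ))
        - ((I.k * ∑ B, (I.stateAfter M α (σ.take 0)).level B : ℕ)
          - ((I.stateAfter M α (σ.take 0)).mass M : ℝ)) := by
    rw [activeSteps, Nat.cast_sum]
    refine sum_fin_le_of_step _ (fun t => ((I.k * ∑ B, (I.stateAfter M α (σ.take t)).level B : ℕ)
          - ((I.stateAfter M α (σ.take t)).mass M : ℝ))) fun t => ?_
    have := mass_serve_le (I := I) (α := α) hM (I.stateAfter M α (σ.take t)) σ[t]
    rw [stateAfter_take_succ σ t t.2]
    have h := (Nat.cast_le (α := ℝ)).2 this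
    simp only [Nat.cast_add] at h
    simp only [Fin.getElem_fin] at h ⊢
    linarith
  have h2 : (I.stateAfter M α (σ.take 0)).mass M = Fintype.card Page * M := by
    simp [stateAfter, mass, initialState]
  have h3 : ∑ B, (I.stateAfter M α (σ.take 0)).level B = 0 := by
    simp [stateAfter, initialState]
  have h4 := (stateAfter_saturated (I := I) (M := M) (α := α) hk σ).le_mass hα
  rw [h2, h3, List.take_length] at h1
  have h5 : I.activeSteps M α σ + (I.stateAfter M α σ).mass M
      ≤ I.k * ∑ B, (I.stateAfter M α σ).level B + Fintype.card Page * M := by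
    rw [← Nat.cast_le (α := ℝ)]
    push_cast at h1 ⊢
    linarith
  omega

/-! ### The expected number of flushes -/

/-- Raising `l` by one shifts the window of `M` quotients and replaces `l / M` by `l / M + 1`. -/
theorem sum_add_div (hM : 0 < M) (l : ℕ) : ∑ t : Fin M, (l + t) / M = l := by
  rw [Fin.sum_univ_eq_sum_range (fun t => (l + t) / M)]
  induction l with
  | zero =>
    refine Finset.sum_eq_zero fun t ht => ?_
    rw [zero_add]
    exact Nat.div_eq_of_lt (Finset.mem_range.1 ht)
  | succ l ih =>
    have h1 := Finset.sum_range_succ (fun t => (l + t) / M) M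
    have h2 := Finset.sum_range_succ' (fun t => (l + t) / M) M
    rw [Nat.add_div_right _ hM] at h1
    have h3 : ∑ t ∈ Finset.range M, (l + 1 + t) / M
        = ∑ t ∈ Finset.range M, (l + (t + 1)) / M :=
      Finset.sum_congr rfl fun t _ => by rw [add_assoc, add_comm 1 t]
    simp only [add_zero] at h2
    omega

theorem sum_add_mod (hM : 0 < M) (l : ℕ) (f : ℕ → ℝ) :
    ∑ t : Fin M, f ((l + t) % M) = ∑ j ∈ Finset.range M, f j := by
  have : NeZero M := ⟨hM.ne'⟩
  rw [← Fin.sum_univ_eq_sum_range]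
  refine Fintype.sum_equiv (Equiv.addLeft (Fin.ofNat M l)) _ _ fun t => ?_
  simp [Fin.val_add]

/-! ### The potential -/

/-- The potential of a block that has been flushed by an amount `w` since an offline policy flushed
it last. -/
noncomputable def logPotential (M : ℕ) (A : ℝ) (w : ℕ) : ℝ :=
  Real.log ((M + 2 * A) / (min (w : ℝ) (M + A) + A))

theorem logPotential_nonneg {A : ℝ} (hA : 0 < A) (w : ℕ) : 0 ≤ logPotential M A w := by
  refine Real.log_nonneg ?_
  have : (0 : ℝ) ≤ min (w : ℝ) (M + A) := by positivity
  rw [one_le_div (by linarith)]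
  linarith [min_le_right (w : ℝ) (M + A)]

theorem logPotential_zero {A : ℝ} (hA : 0 < A) :
    logPotential M A 0 = Real.log ((M + 2 * A) / A) := by
  have : min (0 : ℝ) (M + A) = 0 := min_eq_left (by positivity)
  simp [logPotential, this]

theorem logPotential_of_le {A : ℝ} (hA : 0 < A) {w : ℕ} (hw : M + A ≤ w) :
    logPotential M A w = 0 := by
  rw [logPotential, min_eq_right hw, show (M : ℝ) + A + A = M + 2 * A by ring, div_self, Real.log_one]
  positivity

theorem logPotential_anti {A : ℝ} (hA : 0 < A) {w w' : ℕ} (h : w ≤ w') :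
    logPotential M A w' ≤ logPotential M A w := by
  have h0 : (0 : ℝ) ≤ min (w : ℝ) (M + A) := by positivity
  have h1 : min (w : ℝ) (M + A) ≤ min (w' : ℝ) (M + A) :=
    min_le_min_right _ (by exact_mod_cast h)
  refine Real.log_le_log (by apply div_pos <;> [positivity; linarith]) ?_
  exact div_le_div_of_nonneg_left (by positivity) (by linarith) (by linarith)

/-- The cap at `M + A` is not reached, so the drop is the logarithm of `(w + n + A) / (w + A)`. Now
`1 - 1 / x ≤ log x`, and `n ≤ A` costs the factor 2. -/
theorem logPotential_drop {A : ℝ} (hA : 0 < A) {w n : ℕ} (hw : w < M) (hn : n ≤ A) :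
    n / (2 * (w + A)) ≤ logPotential M A w - logPotential M A (w + n) := by
  have hwM : (w : ℝ) < M := by exact_mod_cast hw
  have hw0 : (0 : ℝ) ≤ w := by positivity
  have hn0 : (0 : ℝ) ≤ n := by positivity
  have h1 : min (w : ℝ) (M + A) = w := min_eq_left (by linarith)
  have h2 : min ((w + n : ℕ) : ℝ) (M + A) = w + n := by
    push_cast; exact min_eq_left (by linarith)
  rw [logPotential, logPotential, h1, h2,
    ← Real.log_div (by positivity) (by positivity)]
  have h3 : ((M : ℝ) + 2 * A) / (w + A) / ((M + 2 * A) / (w + n + A)) = (w + n + A) / (w + A) := by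
    have : (M : ℝ) + 2 * A ≠ 0 := by positivity
    field_simp
  rw [h3]
  refine le_trans ?_ (Real.one_sub_inv_le_log_of_pos (by positivity))
  rw [inv_div, one_sub_div (by positivity), div_le_div_iff₀ (by positivity) (by positivity)]
  nlinarith [mul_nonneg hn0 (sub_nonneg.2 hn), mul_nonneg hn0 hw0]

/-! ### Charging the rounds to an offline policy -/

/-- The number of young pages of `B` outside `C`. -/
def missing (I : BlockCaching Page Block) (M : ℕ) (s : FlushState Page Block) (C : Finset Page)
    (B : Block) : ℕ :=
  ((s.young M \ C).filter fun q => I.block q = B).card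

theorem deficit_le_sum_missing {s : FlushState Page Block} {C : Finset Page}
    (hC : C.card ≤ I.k) : I.deficit M s ≤ ∑ B, I.missing M s C B := by
  have h : ∑ B, I.missing M s C B = (s.young M \ C).card :=
    (Finset.card_eq_sum_card_fiberwise (fun _ _ => Finset.mem_coe.2 (Finset.mem_univ _))).symm
  have := Finset.le_card_sdiff C (s.young M)
  unfold deficit
  omega

/-- Either one term alone meets the demand `d`, or no term is truncated. Hence truncation at the
deficit is harmless for the offline cache. -/
theorem le_sum_min {ι : Type*} (s : Finset ι) (f : ι → ℕ) {d : ℕ} (h : d ≤ ∑ i ∈ s, f i) :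
    d ≤ ∑ i ∈ s, min d (f i) := by
  by_cases hex : ∃ i ∈ s, d ≤ f i
  · obtain ⟨i, hi, hd⟩ := hex
    exact (min_eq_left hd).symm.le.trans
      (Finset.single_le_sum (f := fun i => min d (f i)) (fun _ _ => Nat.zero_le _) hi)
  · push Not at hex
    rwa [Finset.sum_congr rfl fun i hi => min_eq_right (hex i hi).le]

/-- Every page outside the offline cache `C` is at least as old as the last offline flush of its
block, after which the online algorithm flushed `B` by the amount `w B`. -/
def Dominates (I : BlockCaching Page Block) (M : ℕ) (s : FlushState Page Block) (w : Block → ℕ)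
    (C : Finset Page) : Prop :=
  ∀ q, q ∉ C → min (w (I.block q)) M ≤ s.age q

theorem Dominates.mul_le_coverage {s : FlushState Page Block} {w : Block → ℕ} {C : Finset Page}
    (h : I.Dominates M s w C) {B : Block} (hw : w B ≤ M) :
    w B * min (I.deficit M s) (I.missing M s C B) ≤ I.coverage M s B := by
  calc w B * min (I.deficit M s) (I.missing M s C B)
      = ∑ _j ∈ Finset.range (w B), min (I.deficit M s) (I.missing M s C B) := by simp
    _ ≤ ∑ j ∈ Finset.range (w B), min (I.deficit M s) (I.covered M s B j) := by
        refine Finset.sum_le_sum fun j hj => min_le_min_left _ (Finset.card_le_card ?_)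
        intro q
        simp only [Finset.mem_filter, Finset.mem_sdiff]
        rintro ⟨⟨hy, hC⟩, rfl⟩
        refine ⟨hy, rfl, ?_⟩
        have := h q hC
        have := Finset.mem_range.1 hj
        omega
    _ ≤ I.coverage M s B :=
        Finset.sum_le_sum_of_subset (Finset.range_subset_range.2 hw)

theorem Dominates.lt_of_missing {s : FlushState Page Block} {w : Block → ℕ} {C : Finset Page}
    (h : I.Dominates M s w C) {B : Block} (hB : 0 < I.missing M s C B) : w B < M := by
  obtain ⟨q, hq⟩ := Finset.card_pos.1 hB
  simp only [young, Finset.mem_filter, Finset.mem_sdiff, Finset.mem_univ, true_and] at hq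
  obtain ⟨⟨hy, hC⟩, rfl⟩ := hq
  have := h q hC
  omega

theorem missing_le_youngCard (s : FlushState Page Block) (C : Finset Page) (B : Block) :
    I.missing M s C B ≤ I.youngCard M s B :=
  Finset.card_le_card (Finset.filter_subset_filter _ Finset.sdiff_subset)

theorem coverage_le_mul_youngCard (s : FlushState Page Block) (B : Block) :
    I.coverage M s B ≤ M * I.youngCard M s B := by
  calc I.coverage M s B ≤ ∑ _j ∈ Finset.range M, I.youngCard M s B := by
        refine Finset.sum_le_sum fun j _ => (min_le_right _ _).trans (Finset.card_le_card ?_)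
        intro q; simp only [Finset.mem_filter]; tauto
    _ = _ := by simp

theorem youngCard_le (s : FlushState Page Block) (B : Block) : I.youngCard M s B ≤ I.k :=
  (Finset.card_le_card (Finset.filter_subset_filter _ (Finset.subset_univ _))).trans
    ((I.card_block_le B).trans I.β_le_k)

theorem shift_pos (hM : 0 < M) (hα : 1 ≤ α) (hk : 1 ≤ I.k) : 0 < I.shift M α := by
  have : 0 < α := hα
  have : 0 < I.k := hk
  unfold shift; positivity

/-- Rounding up at most doubles: with a young page in `B` the rounded number is at least 1, and
without one it is 0. -/
theorem c_mul_increment_le (hM : 0 < M) (hα : 1 ≤ α) (hk : 1 ≤ I.k) (s : FlushState Page Block)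
    (B : Block) : I.c B * I.increment M α s B
      ≤ 2 * (⨆ B', I.c B') * (I.coverage M s B / I.shift M α + I.youngCard M s B) := by
  have hA := shift_pos (I := I) hM hα hk
  have hc := c_le_iSup (I := I) B
  have hcB := I.c_pos B
  have hsup : 0 < ⨆ B', I.c B' := hcB.trans_le hc
  rcases Nat.eq_zero_or_pos (I.youngCard M s B) with h0 | h0
  · have h1 : I.coverage M s B = 0 := by
      have := coverage_le_mul_youngCard (I := I) (M := M) s B
      rw [h0] at this; omega
    simp [increment, h0, h1]
  · have h1 : (1 : ℝ) ≤ I.youngCard M s B := by exact_mod_cast h0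
    have h2 : (0 : ℝ) ≤ I.coverage M s B / I.shift M α := by positivity
    have h3 : (1 : ℝ) ≤ (⨆ B', I.c B') / I.c B := (one_le_div hcB).2 hc
    set x := (⨆ B', I.c B') / I.c B * (I.coverage M s B / I.shift M α + I.youngCard M s B) with hx
    have h4 : 1 ≤ x := by nlinarith
    have h5 : (I.increment M α s B : ℝ) ≤ 2 * x := by
      have := Nat.ceil_lt_add_one (zero_le_one.trans h4)
      rw [increment, ← hx]
      linarith
    calc I.c B * I.increment M α s B ≤ I.c B * (2 * x) := mul_le_mul_of_nonneg_left h5 hcB.le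
      _ = _ := by rw [hx]; field_simp

theorem le_c_mul_increment (s : FlushState Page Block) (B : Block) :
    (⨆ B', I.c B') * (I.coverage M s B / I.shift M α + I.youngCard M s B)
      ≤ I.c B * I.increment M α s B := by
  have hcB := I.c_pos B
  calc _ = I.c B * ((⨆ B', I.c B') / I.c B
        * (I.coverage M s B / I.shift M α + I.youngCard M s B)) := by field_simp
    _ ≤ _ := mul_le_mul_of_nonneg_left (Nat.le_ceil _) hcB.le

theorem iInf_c_pos [Nonempty Block] : 0 < ⨅ B, I.c B := by
  obtain ⟨B, hB⟩ := exists_eq_ciInf_of_finite (f := I.c)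
  rw [← hB]; exact I.c_pos B

theorem iInf_le_c (B : Block) : ⨅ B', I.c B' ≤ I.c B :=
  ciInf_le (Set.finite_range I.c).bddBelow B

/-- The unit `1 / M` is so fine that no round moves a block by more than the shift, as
`logPotential_drop` requires. -/
theorem increment_le [Nonempty Block] (hα : 1 ≤ α) (hk : 1 ≤ I.k)
    (hM : 2 * I.aspectRatio * I.k ^ 2 * (I.k + 1) ≤ M) (hM0 : 0 < M) (s : FlushState Page Block)
    (B : Block) : (I.increment M α s B : ℝ) ≤ I.shift M α := by
  have hA := shift_pos (I := I) hM0 hα hk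
  have hcB := I.c_pos B
  have hsup : 0 < ⨆ B', I.c B' := iSup_c_pos
  have hinf : 0 < ⨅ B', I.c B' := iInf_c_pos
  have hM' : (0 : ℝ) < M := by exact_mod_cast hM0
  have hα' : (1 : ℝ) ≤ α := by exact_mod_cast hα
  have hk' : (1 : ℝ) ≤ I.k := by exact_mod_cast hk
  have hy : (I.youngCard M s B : ℝ) ≤ I.k := by exact_mod_cast youngCard_le s B
  have hcov : (I.coverage M s B : ℝ) ≤ M * I.k := by
    have h := coverage_le_mul_youngCard (I := I) (M := M) s B
    have h' := h.trans (Nat.mul_le_mul_left M (youngCard_le (I := I) (M := M) s B))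
    exact_mod_cast h'
  have h1 : I.coverage M s B / I.shift M α ≤ (I.k : ℝ) ^ 2 := by
    rw [div_le_iff₀ hA, shift]
    refine hcov.trans ?_
    have : (I.k : ℝ) ^ 2 * (α * M / I.k) = M * I.k * α := by field_simp
    rw [this]
    exact le_mul_of_one_le_right (by positivity) hα'
  have h2 := c_mul_increment_le (I := I) hM0 hα hk s B
  have h3 : (⨆ B', I.c B') ≤ I.aspectRatio * I.c B := by
    rw [aspectRatio, div_mul_eq_mul_div, le_div_iff₀ hinf]
    exact mul_le_mul_of_nonneg_left (iInf_le_c B) hsup.le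
  have h5 : 0 ≤ I.aspectRatio := div_nonneg hsup.le hinf.le
  have h4 : I.c B * I.increment M α s B
      ≤ I.c B * (2 * I.aspectRatio * ((I.k : ℝ) ^ 2 + I.k)) := by
    refine h2.trans ?_
    calc 2 * (⨆ B', I.c B') * (I.coverage M s B / I.shift M α + I.youngCard M s B)
        ≤ 2 * (I.aspectRatio * I.c B) * ((I.k : ℝ) ^ 2 + I.k) := by gcongr
      _ = _ := by ring
  refine (le_of_mul_le_mul_left h4 hcB).trans ?_
  rw [shift, le_div_iff₀ (by linarith)]
  calc 2 * I.aspectRatio * ((I.k : ℝ) ^ 2 + I.k) * I.k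
      = 2 * I.aspectRatio * (I.k : ℝ) ^ 2 * (I.k + 1) := by ring
    _ ≤ (M : ℝ) := hM
    _ ≤ (α : ℝ) * M := le_mul_of_one_le_left hM'.le hα'

/-- The total potential. -/
noncomputable def potential (I : BlockCaching Page Block) (M α : ℕ) (w : Block → ℕ) : ℝ :=
  ∑ B, I.c B * logPotential M (I.shift M α) (w B)

/-- The form of the increment is made for this. With `m` the truncated number of missing pages and
`A` the shift, `coverage / A + youngCard` is at least `m * (w B + A) / A`, and the slope of the
potential cancels `w B + A`. -/
theorem Dominates.block_drop [Nonempty Block] (hM0 : 0 < M) (hα : 1 ≤ α) (hk : 1 ≤ I.k)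
    (hM : 2 * I.aspectRatio * I.k ^ 2 * (I.k + 1) ≤ M)
    {s : FlushState Page Block} {w : Block → ℕ} {C : Finset Page}
    (h : I.Dominates M s w C) (B : Block) :
    (⨆ B', I.c B') / (2 * I.shift M α) * (min (I.deficit M s) (I.missing M s C B) : ℕ)
      ≤ I.c B * (logPotential M (I.shift M α) (w B)
          - logPotential M (I.shift M α) (w B + I.increment M α s B)) := by
  have hA := shift_pos (I := I) hM0 hα hk
  have hcB := I.c_pos B
  rcases Nat.eq_zero_or_pos (I.missing M s C B) with h0 | h0
  · rw [h0, Nat.min_zero, Nat.cast_zero, mul_zero]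
    exact mul_nonneg hcB.le (sub_nonneg.2 (logPotential_anti hA (Nat.le_add_right _ _)))
  · have hw := h.lt_of_missing h0
    have hdrop := logPotential_drop hA hw (increment_le hα hk hM hM0 s B)
    have hsup : 0 < ⨆ B', I.c B' := iSup_c_pos
    set m := min (I.deficit M s) (I.missing M s C B) with hm
    have h1 : (w B : ℝ) * m ≤ I.coverage M s B := by exact_mod_cast h.mul_le_coverage hw.le
    have h2 : (m : ℝ) ≤ I.youngCard M s B := by
      exact_mod_cast (min_le_right _ _).trans (missing_le_youngCard s C B)
    have h3 := le_c_mul_increment (I := I) (M := M) (α := α) s B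
    have hwA : 0 < (w B : ℝ) + I.shift M α := by positivity
    calc (⨆ B', I.c B') / (2 * I.shift M α) * m
        = (⨆ B', I.c B') * (w B * m / I.shift M α + m) / (2 * (w B + I.shift M α)) := by
          field_simp
      _ ≤ (⨆ B', I.c B') * (I.coverage M s B / I.shift M α + I.youngCard M s B)
            / (2 * (w B + I.shift M α)) := by gcongr
      _ ≤ I.c B * I.increment M α s B / (2 * (w B + I.shift M α)) := by gcongr
      _ = I.c B * (I.increment M α s B / (2 * (w B + I.shift M α))) := by ring
      _ ≤ _ := mul_le_mul_of_nonneg_left hdrop hcB.le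

theorem Dominates.relax [Nonempty Block] (hM0 : 0 < M) (hα : 1 ≤ α) (hk : 1 ≤ I.k)
    (hM : 2 * I.aspectRatio * I.k ^ 2 * (I.k + 1) ≤ M)
    {s : FlushState Page Block} {w : Block → ℕ} {C : Finset Page}
    (h : I.Dominates M s w C) (hC : C.card ≤ I.k) {p : Page} (hp : p ∈ C) :
    ∃ w', I.Dominates M (I.relax M α p s) w' C ∧
      ∑ B, I.c B * (I.relax M α p s).level B + 12 * α * M * I.potential M α w'
        ≤ ∑ B, I.c B * s.level B + 12 * α * M * I.potential M α w := by
  by_cases hs : I.Saturated M α s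
  · exact ⟨w, by simpa [BlockCaching.relax, hs] using h, by simp [BlockCaching.relax, hs]⟩
  refine ⟨fun B => w B + I.increment M α s B, ?_, ?_⟩
  · intro q hq
    have hqp : q ≠ p := fun e => hq (e ▸ hp)
    have := h q hq
    simp only [BlockCaching.relax, hs, if_false, bump, hqp]
    omega
  have hA := shift_pos (I := I) hM0 hα hk
  have hsup : 0 < ⨆ B', I.c B' := iSup_c_pos
  have hk' : (1 : ℝ) ≤ I.k := by exact_mod_cast hk
  have hα' : (1 : ℝ) ≤ α := by exact_mod_cast hα
  have hM' : (0 : ℝ) < M := by exact_mod_cast hM0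
  have hs' : ∑ B, I.coverage M s B < α * M * I.deficit M s := not_le.1 hs
  have hD : 1 ≤ I.deficit M s := by
    by_contra h0
    have : I.deficit M s = 0 := by omega
    rw [this] at hs'; omega
  have hD' : (1 : ℝ) ≤ I.deficit M s := by exact_mod_cast hD
  set D : ℝ := ((I.deficit M s : ℕ) : ℝ) with hDdef
  have hdrop : (⨆ B', I.c B') / (2 * I.shift M α) * D
      ≤ I.potential M α w - I.potential M α (fun B => w B + I.increment M α s B) := by
    have h1 : D ≤ ∑ B, ((min (I.deficit M s) (I.missing M s C B) : ℕ) : ℝ) := by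
      rw [hDdef]
      exact_mod_cast le_sum_min Finset.univ _ (deficit_le_sum_missing (M := M) (s := s) hC)
    rw [potential, potential, ← Finset.sum_sub_distrib]
    refine (mul_le_mul_of_nonneg_left h1 (by positivity)).trans ?_
    rw [Finset.mul_sum]
    refine Finset.sum_le_sum fun B _ => ?_
    rw [← mul_sub]
    exact h.block_drop hM0 hα hk hM B
  have hcost : ∑ B, I.c B * I.increment M α s B ≤ 6 * (⨆ B', I.c B') * I.k * D := by
    have h1 : (∑ B, (I.coverage M s B : ℝ)) ≤ α * M * D := by
      rw [hDdef]
      exact_mod_cast hs'.le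
    have h2 : ∑ B, (I.youngCard M s B : ℝ) = D + I.k := by
      have := sum_youngCard (I := I) (M := M) s
      have h3 : (s.young M).card = I.deficit M s + I.k := by
        unfold deficit at hD ⊢; omega
      rw [h3] at this
      rw [hDdef]
      exact_mod_cast this
    calc ∑ B, I.c B * I.increment M α s B
        ≤ ∑ B, 2 * (⨆ B', I.c B') * (I.coverage M s B / I.shift M α + I.youngCard M s B) :=
          Finset.sum_le_sum fun B _ => c_mul_increment_le hM0 hα hk s B
      _ = 2 * (⨆ B', I.c B') * ((∑ B, (I.coverage M s B : ℝ)) / I.shift M α + (D + I.k)) := by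
          rw [← Finset.mul_sum, Finset.sum_add_distrib, h2, Finset.sum_div]
      _ ≤ 2 * (⨆ B', I.c B') * (α * M * D / I.shift M α + (D + I.k)) := by gcongr
      _ = 2 * (⨆ B', I.c B') * (I.k * D + (D + I.k)) := by
          rw [shift]; field_simp
      -- Both `D` and `k` are at least 1, so each is at most `k * D`.
      _ ≤ 2 * (⨆ B', I.c B') * (3 * I.k * D) := by
          refine mul_le_mul_of_nonneg_left ?_ (by positivity)
          nlinarith
      _ = _ := by ring
  have hlevel : ∑ B, I.c B * ((I.relax M α p s).level B : ℝ)
      = ∑ B, I.c B * s.level B + ∑ B, I.c B * I.increment M α s B := by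
    simp [BlockCaching.relax, hs, bump, mul_add, Finset.sum_add_distrib]
  -- The factor `12 * α * M` is the ratio of the bound on the cost of a round to the guaranteed drop
  -- of the potential.
  have hfin : 12 * α * M * ((⨆ B', I.c B') / (2 * I.shift M α) * D)
      = 6 * (⨆ B', I.c B') * I.k * D := by
    rw [shift]; field_simp; ring
  have := mul_le_mul_of_nonneg_left hdrop (by positivity : (0 : ℝ) ≤ 12 * α * M)
  rw [hlevel]
  linarith

theorem Dominates.serve [Nonempty Block] (hM0 : 0 < M) (hα : 1 ≤ α) (hk : 1 ≤ I.k)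
    (hM : 2 * I.aspectRatio * I.k ^ 2 * (I.k + 1) ≤ M)
    {s : FlushState Page Block} {w : Block → ℕ} {C C' : Finset Page}
    (h : I.Dominates M s w C) (hC : C'.card ≤ I.k) {p : Page} (hp : p ∈ C') :
    ∃ w', I.Dominates M (I.serve M α s p) w' C' ∧
      ∑ B, I.c B * (I.serve M α s p).level B + 12 * α * M * I.potential M α w'
        ≤ ∑ B, I.c B * s.level B + 12 * α * M * (I.potential M α w
          + Real.log ((M + 2 * I.shift M α) / I.shift M α) * I.stepCost C C') := by
  have hA := shift_pos (I := I) hM0 hα hk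
  refine serve_induction (fun s' => ∃ w', I.Dominates M s' w' C' ∧
    ∑ B, I.c B * s'.level B + 12 * α * M * I.potential M α w'
        ≤ ∑ B, I.c B * s.level B + 12 * α * M * (I.potential M α w
          + Real.log ((M + 2 * I.shift M α) / I.shift M α) * I.stepCost C C')) ?_ ?_
  -- An offline eviction from `B` restarts its clock. Pages leave the offline cache only in such
  -- blocks, so domination survives.
  · refine ⟨fun B => if B ∈ (C \ C').image I.block then 0 else w B, ?_, ?_⟩
    · intro q hq
      have hqp : q ≠ p := fun e => hq (e ▸ hp)
      simp only [Function.update_of_ne hqp]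
      split_ifs with hB
      · simp
      · refine h q fun hqC => hB (Finset.mem_image_of_mem _ (Finset.mem_sdiff.2 ⟨hqC, hq⟩))
    · refine add_le_add_right (mul_le_mul_of_nonneg_left ?_ (by positivity)) _
      rw [stepCost, potential, potential,
        Finset.mul_sum]
      have : ∑ B ∈ (C \ C').image I.block, Real.log ((M + 2 * I.shift M α) / I.shift M α) * I.c B
          = ∑ B, if B ∈ (C \ C').image I.block then
              Real.log ((M + 2 * I.shift M α) / I.shift M α) * I.c B else 0 := by
        rw [Finset.sum_ite_mem, Finset.univ_inter]
      rw [this, ← Finset.sum_add_distrib]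
      refine Finset.sum_le_sum fun B _ => ?_
      split_ifs
      · rw [logPotential_zero hA, mul_comm]
        exact le_add_of_nonneg_left (mul_nonneg (I.c_pos B).le (logPotential_nonneg hA _))
      · simp
  · rintro s' ⟨w', hw', hle⟩
    obtain ⟨w'', hw'', hle'⟩ := hw'.relax hM0 hα hk hM hC hp
    exact ⟨w'', hw'', hle'.trans hle⟩

theorem level_cost_le [Nonempty Block] (hM0 : 0 < M) (hα : 1 ≤ α) (hk : 1 ≤ I.k)
    (hM : 2 * I.aspectRatio * I.k ^ 2 * (I.k + 1) ≤ M) {σ : List Page} {C : ℕ → Finset Page}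
    (hC : I.IsFeasible σ C) :
    ∑ B, I.c B * ((I.stateAfter M α σ).level B : ℝ)
      ≤ 12 * α * M * (Real.log ((M + 2 * I.shift M α) / I.shift M α) * I.cost σ C) := by
  have hA := shift_pos (I := I) hM0 hα hk
  set G := Real.log ((M + 2 * I.shift M α) / I.shift M α) with hG
  have key : ∀ t ≤ σ.length, ∃ w, I.Dominates M (I.stateAfter M α (σ.take t)) w (C t) ∧
      ∑ B, I.c B * ((I.stateAfter M α (σ.take t)).level B : ℝ) + 12 * α * M * I.potential M α w
        ≤ 12 * α * M * (G * ∑ i ∈ Finset.range t, I.stepCost (C i) (C (i + 1))) := by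
    intro t
    induction t with
    | zero =>
      intro _
      -- This exceeds the cap, as `shift ≤ α * M`, so the initial potential is zero.
      refine ⟨fun _ => M + α * M, ?_, ?_⟩
      · intro q _
        simp [stateAfter, initialState]
      · have h1 : (M : ℝ) + I.shift M α ≤ ((M + α * M : ℕ) : ℝ) := by
          push_cast
          rw [shift]
          have : (α * M : ℝ) / I.k ≤ α * M :=
            div_le_self (by positivity) (by exact_mod_cast hk)
          linarith
        simp [stateAfter, initialState, potential, logPotential_of_le hA h1]
    | succ t ih =>
      intro ht
      obtain ⟨w, hw, hle⟩ := ih (by omega)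
      obtain ⟨w', hw', hle'⟩ := hw.serve hM0 hα hk hM (hC.card_le (t + 1) ht) (hC.serves t ht)
      refine ⟨w', ?_, ?_⟩
      · rwa [stateAfter_take_succ σ t ht]
      · rw [stateAfter_take_succ σ t ht, Finset.sum_range_succ]
        rw [mul_add] at hle'
        rw [mul_add G, mul_add]
        linarith
  obtain ⟨w, -, hle⟩ := key σ.length le_rfl
  rw [List.take_length] at hle
  have h0 : 0 ≤ I.potential M α w :=
    Finset.sum_nonneg fun B _ => mul_nonneg (I.c_pos B).le (logPotential_nonneg hA _)
  have : 0 ≤ 12 * α * M * I.potential M α w := by positivity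
  unfold cost
  linarith

/-! ### The probability that the retained pages do not fit -/

theorem exp_neg_le {x : ℝ} (h0 : 0 ≤ x) (h1 : x ≤ 1) : Real.exp (-x) ≤ 1 - x / 2 := by
  have h2 : x + 1 ≤ Real.exp x := Real.add_one_le_exp x
  rw [Real.exp_neg, inv_le_comm₀ (Real.exp_pos x) (by linarith)]
  refine le_trans ?_ h2
  rw [inv_le_comm₀ (by linarith) (by linarith), inv_le_iff_one_le_mul₀ (by linarith)]
  nlinarith

-- A Chernoff bound in counting form: the sum of `exp (-∑ i, g i (θ i))` factorizes over the
-- independent coordinates, each average is at most `exp (-mean / 2)`, and Markov's inequality loses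
-- a factor `e`.
open Classical in
theorem card_sum_lt_one_le {ι : Type*} [Fintype ι] (hM : 0 < M) (g : ι → Fin M → ℝ)
    (h0 : ∀ i j, 0 ≤ g i j) (h1 : ∀ i j, g i j ≤ 1) {a : ℝ} (ha : a * M ≤ ∑ i, ∑ j, g i j) :
    ((Finset.univ.filter fun θ : ι → Fin M => ∑ i, g i (θ i) < 1).card : ℝ)
      ≤ (M : ℝ) ^ Fintype.card ι * Real.exp (1 - a / 2) := by
  have hM' : (0 : ℝ) < M := by exact_mod_cast hM
  have hrow : ∀ i, ∑ j, Real.exp (-g i j) ≤ M * Real.exp (-(∑ j, g i j) / (2 * M)) := by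
    intro i
    calc ∑ j, Real.exp (-g i j) ≤ ∑ j, (1 - g i j / 2) :=
          Finset.sum_le_sum fun j _ => exp_neg_le (h0 i j) (h1 i j)
      _ = M * (-(∑ j, g i j) / (2 * M) + 1) := by
          rw [Finset.sum_sub_distrib, ← Finset.sum_div]
          simp only [Finset.sum_const, Finset.card_univ, Fintype.card_fin, nsmul_eq_mul, mul_one]
          field_simp
          ring
      _ ≤ _ := mul_le_mul_of_nonneg_left (Real.add_one_le_exp _) hM'.le
  have hprod : ∑ θ : ι → Fin M, Real.exp (-∑ i, g i (θ i))
      ≤ (M : ℝ) ^ Fintype.card ι * Real.exp (-a / 2) := by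
    calc ∑ θ : ι → Fin M, Real.exp (-∑ i, g i (θ i))
        = ∑ θ : ι → Fin M, ∏ i, Real.exp (-g i (θ i)) := by
          simp_rw [← Finset.sum_neg_distrib, Real.exp_sum]
      _ = ∏ i, ∑ j, Real.exp (-g i j) := by
          rw [Finset.prod_univ_sum, Fintype.piFinset_univ]
      _ ≤ ∏ i, (M * Real.exp (-(∑ j, g i j) / (2 * M))) :=
          Finset.prod_le_prod (fun i _ => Finset.sum_nonneg fun j _ => (Real.exp_pos _).le)
            fun i _ => hrow i
      _ = (M : ℝ) ^ Fintype.card ι * Real.exp (-(∑ i, ∑ j, g i j) / (2 * M)) := by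
          rw [Finset.prod_mul_distrib, ← Real.exp_sum, ← Finset.sum_div, Finset.sum_neg_distrib]
          simp
      _ ≤ _ := by
          refine mul_le_mul_of_nonneg_left (Real.exp_le_exp.2 ?_) (by positivity)
          rw [div_le_div_iff₀ (by positivity) (by positivity)]
          nlinarith
  have hmarkov : ((Finset.univ.filter fun θ : ι → Fin M => ∑ i, g i (θ i) < 1).card : ℝ)
      * Real.exp (-1) ≤ ∑ θ : ι → Fin M, Real.exp (-∑ i, g i (θ i)) := by
    rw [← nsmul_eq_mul]
    refine (Finset.card_nsmul_le_sum _ (fun θ => Real.exp (-∑ i, g i (θ i))) _ ?_).trans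
      (Finset.sum_le_sum_of_subset_of_nonneg (Finset.filter_subset _ _)
        fun _ _ _ => (Real.exp_pos _).le)
    intro θ hθ
    exact Real.exp_le_exp.2 (neg_le_neg (Finset.mem_filter.1 hθ).2.le)
  have h := hmarkov.trans hprod
  rw [Real.exp_neg, ← div_eq_mul_inv, div_le_iff₀ (Real.exp_pos 1), mul_assoc, ← Real.exp_add] at h
  rwa [show 1 - a / 2 = -a / 2 + 1 by ring]

theorem card_retained_add (hM : 0 < M) (s : FlushState Page Block) (θ : Block → Fin M) :
    (I.retained M s θ).card + ∑ B, I.covered M s B ((s.level B + θ B) % M)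
      = (s.young M).card := by
  have h1 : I.retained M s θ = (s.young M).filter
      fun q => s.age q ≤ (s.level (I.block q) + θ (I.block q)) % M := by
    ext q
    simp only [retained, young, Finset.mem_filter, Finset.mem_univ, true_and]
    have := Nat.mod_lt (s.level (I.block q) + θ (I.block q)) hM
    omega
  have h2 : ∑ B, I.covered M s B ((s.level B + θ B) % M) = ((s.young M).filter
      fun q => ¬ s.age q ≤ (s.level (I.block q) + θ (I.block q)) % M).card := by
    rw [Finset.card_eq_sum_card_fiberwise (f := I.block) (t := Finset.univ)
      (fun _ _ => Finset.mem_coe.2 (Finset.mem_univ _))]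
    refine Finset.sum_congr rfl fun B _ => ?_
    unfold covered
    congr 1
    ext q
    simp only [Finset.mem_filter, not_le]
    constructor
    · rintro ⟨h, rfl, h'⟩; exact ⟨⟨h, h'⟩, rfl⟩
    · rintro ⟨⟨h, h'⟩, rfl⟩; exact ⟨h, rfl, h'⟩
  rw [h1, h2, Finset.card_filter_add_card_filter_not]

-- Overflow means that the flushed blocks cover less than the deficit. Truncated at the deficit and
-- divided by it, their contributions are independent with values in `[0, 1]`, and saturation says
-- that the means add up to at least `α`.
open Classical in
theorem card_overflow_le (hM : 0 < M) {s : FlushState Page Block} (hs : I.Saturated M α s) :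
    ((Finset.univ.filter fun θ : Block → Fin M => I.k < (I.retained M s θ).card).card : ℝ)
      ≤ (M : ℝ) ^ Fintype.card Block * Real.exp (1 - α / 2) := by
  rcases Nat.eq_zero_or_pos (I.deficit M s) with h0 | h0
  · rw [Finset.filter_false_of_mem, Finset.card_empty, Nat.cast_zero]
    · positivity
    · intro θ _
      have := card_retained_add (I := I) hM s θ
      unfold deficit at h0
      omega
  have hD : (0 : ℝ) < I.deficit M s := by exact_mod_cast h0
  let g : Block → ℕ → ℝ := fun B j =>
    ((min (I.deficit M s) (I.covered M s B j) : ℕ) : ℝ) / I.deficit M s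
  refine le_trans ?_ (card_sum_lt_one_le hM (fun B j => g B ((s.level B + j) % M))
    (fun _ _ => by positivity)
    (fun _ _ => (div_le_one hD).2 (by exact_mod_cast min_le_left _ _)) ?_)
  · rw [Nat.cast_le]
    refine Finset.card_le_card fun θ => ?_
    simp only [Finset.mem_filter, Finset.mem_univ, true_and, g]
    intro hθ
    rw [← Finset.sum_div, div_lt_one hD, ← Nat.cast_sum, Nat.cast_lt]
    have h1 := card_retained_add (I := I) hM s θ
    have h2 : ∑ B, min (I.deficit M s) (I.covered M s B ((s.level B + θ B) % M))
        ≤ ∑ B, I.covered M s B ((s.level B + θ B) % M) :=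
      Finset.sum_le_sum fun B _ => min_le_right _ _
    unfold deficit at h0 h2 ⊢
    omega
  · have h1 : ∀ B, ∑ j : Fin M, g B ((s.level B + j) % M)
        = (I.coverage M s B : ℝ) / I.deficit M s := by
      intro B
      rw [sum_add_mod hM _ (g B)]
      simp only [g, coverage]
      rw [← Finset.sum_div, Nat.cast_sum]
    rw [Finset.sum_congr rfl fun B _ => h1 B, ← Finset.sum_div, le_div_iff₀ hD]
    exact_mod_cast hs

/-! ### The algorithm and its cost -/

/-- Each other coordinate contributes a factor `M`; the factor on the left avoids the exponent `card
ι - 1`. -/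
theorem sum_pi_apply {ι : Type*} [Fintype ι] [DecidableEq ι] (i : ι) (f : Fin M → ℝ) :
    M * ∑ θ : ι → Fin M, f (θ i) = (M : ℝ) ^ Fintype.card ι * ∑ j, f j := by
  have h1 := Finset.prod_univ_sum (fun _ : ι => (Finset.univ : Finset (Fin M)))
    (fun i' j => if i' = i then f j else 1)
  rw [Fintype.piFinset_univ] at h1
  have h2 : ∀ θ : ι → Fin M, (∏ i', if i' = i then f (θ i') else 1) = f (θ i) := fun θ => by
    simp
  have h3 : ∀ i', (∑ j, if i' = i then f j else 1) = if i' = i then ∑ j, f j else (M : ℝ) := by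
    intro i'; split_ifs <;> simp
  simp_rw [h2, h3] at h1
  rw [← h1, ← Finset.mul_prod_erase _ _ (Finset.mem_univ i), if_pos rfl,
    Finset.prod_congr rfl (g := fun _ => (M : ℝ))
      fun i' hi' => if_neg (Finset.ne_of_mem_erase hi'),
    Finset.prod_const, Finset.card_erase_of_mem (Finset.mem_univ i), Finset.card_univ]
  obtain ⟨n, hn⟩ : ∃ n, Fintype.card ι = n + 1 :=
    ⟨Fintype.card ι - 1, (Nat.succ_pred_eq_of_pos (Fintype.card_pos_iff.2 ⟨i⟩)).symm⟩
  rw [hn, Nat.add_sub_cancel, pow_succ]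
  ring

open Classical in
theorem cost_cacheOf_le (hM : 0 < M) (hα : 1 ≤ α) (hk : 1 ≤ I.k) (σ : List Page)
    (θ : Block → Fin M) :
    I.cost σ (fun t => I.cacheOf M (I.stateAfter M α (σ.take t)) θ)
      ≤ ∑ B, I.c B * flushes (I.stateAfter M α σ) θ B
        + ∑ t : Fin σ.length, if (I.stateAfter M α (σ.take t)).age σ[t] ≠ 0 then
            if I.k < (I.retained M (I.stateAfter M α (σ.take (t + 1))) θ).card then
              I.k * ⨆ B, I.c B else 0
          else 0 := by
  rw [cost, ← Fin.sum_univ_eq_sum_range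
    (fun t => I.stepCost (I.cacheOf M (I.stateAfter M α (σ.take t)) θ)
      (I.cacheOf M (I.stateAfter M α (σ.take (t + 1))) θ)), ← sub_le_iff_le_add,
    ← Finset.sum_sub_distrib]
  refine (sum_fin_le_of_step _
    (fun t => ∑ B, I.c B * (flushes (I.stateAfter M α (σ.take t)) θ B : ℝ)) fun t => ?_).trans ?_
  · rw [sub_le_iff_le_add, ← Finset.sum_sub_distrib]
    simp_rw [← mul_sub]
    rw [stateAfter_take_succ σ t t.2]
    exact stepCost_serve_le hM hα (stateAfter_saturated hk _) _ θ
  · rw [List.take_length]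
    exact sub_le_self _ (Finset.sum_nonneg fun B _ => mul_nonneg (I.c_pos B).le (by positivity))

theorem sum_cost_cacheOf_le (hM : 0 < M) (hα : 1 ≤ α) (hk : 1 ≤ I.k) (σ : List Page) :
    ∑ θ : Block → Fin M, I.cost σ (fun t => I.cacheOf M (I.stateAfter M α (σ.take t)) θ)
      ≤ (M : ℝ) ^ Fintype.card Block * ((∑ B, I.c B * (I.stateAfter M α σ).level B) / M
        + I.activeSteps M α σ * (Real.exp (1 - α / 2) * (I.k * ⨆ B, I.c B))) := by
  classical
  have hM' : (0 : ℝ) < M := by exact_mod_cast hM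
  have hsup : 0 ≤ ⨆ B, I.c B := Real.iSup_nonneg fun B => (I.c_pos B).le
  refine (Finset.sum_le_sum fun θ _ => cost_cacheOf_le hM hα hk σ θ).trans ?_
  rw [Finset.sum_add_distrib, mul_add]
  refine add_le_add (le_of_eq ?_) ?_
  · rw [Finset.sum_comm, Finset.sum_div, Finset.mul_sum]
    refine Finset.sum_congr rfl fun B _ => ?_
    have h := sum_pi_apply B fun j : Fin M => ((((I.stateAfter M α σ).level B + j) / M : ℕ) : ℝ)
    have hj : ∑ j : Fin M, ((((I.stateAfter M α σ).level B + j) / M : ℕ) : ℝ)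
        = (I.stateAfter M α σ).level B := by
      rw [← Nat.cast_sum, sum_add_div hM]
    rw [hj] at h
    rw [← Finset.mul_sum]
    simp only [flushes]
    field_simp
    linear_combination I.c B * h
  · rw [Finset.sum_comm, activeSteps, Nat.cast_sum, Finset.sum_mul, Finset.mul_sum]
    refine Finset.sum_le_sum fun t _ => ?_
    split_ifs
    · rw [← Finset.sum_filter, Finset.sum_const, nsmul_eq_mul, Nat.cast_one, one_mul]
      have h := mul_le_mul_of_nonneg_right
        (card_overflow_le hM (stateAfter_saturated (I := I) (α := α) hk (σ.take (t + 1))))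
        (by positivity : 0 ≤ I.k * ⨆ B, I.c B)
      rwa [mul_assoc] at h
    · simp

/-- The randomized online algorithm, with uniformly random offsets. -/
noncomputable def roundingAlgorithm (I : BlockCaching Page Block) (M α : ℕ) [NeZero M]
    (hα : 1 ≤ α) (hk : 1 ≤ I.k) : I.RandomizedOnlineAlgorithm where
  Ω := Block → Fin M
  measurableSpace := ⊤
  μ := @PMF.toMeasure _ ⊤ (PMF.uniformOfFintype (Block → Fin M))
  isProbabilityMeasure := @PMF.toMeasure.isProbabilityMeasure _ ⊤ _
  cache θ h := I.cacheOf M (I.stateAfter M α h) θ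
  measurableSet_cache _ _ := trivial
  cache_nil θ := Finset.subset_empty.1
    ((cacheOf_subset_retained _ θ).trans (retained_initialState (NeZero.pos M) θ).subset)
  card_cache_le θ h := card_cacheOf_le (NeZero.pos M) hα (stateAfter_saturated hk h) θ
  mem_cache θ h p := by
    refine fresh_subset_cacheOf _ θ ?_
    rw [stateAfter_append]
    exact Finset.mem_filter.2 ⟨Finset.mem_univ _, age_serve_self _ _⟩

theorem expectedCost_roundingAlgorithm [NeZero M] (hα : 1 ≤ α) (hk : 1 ≤ I.k) (σ : List Page) :
    (I.roundingAlgorithm M α hα hk).expectedCost σ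
      = ((M : ℝ) ^ Fintype.card Block)⁻¹ *
        ∑ θ : Block → Fin M, I.cost σ (fun t => I.cacheOf M (I.stateAfter M α (σ.take t)) θ) := by
  let _ : MeasurableSpace (Block → Fin M) := ⊤
  have h := PMF.integral_eq_sum (PMF.uniformOfFintype (Block → Fin M))
    fun θ => I.cost σ (fun t => I.cacheOf M (I.stateAfter M α (σ.take t)) θ)
  refine Eq.trans h ?_
  rw [Finset.mul_sum]
  refine Finset.sum_congr rfl fun θ _ => ?_
  simp [PMF.uniformOfFintype_apply, smul_eq_mul]

/-- The fractional cost `F` enters twice, through the flushes and through the failures, whence 48 is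
twice 24. The initial mass `k * M` in the bound on active steps leaves one smallest block cost,
which the additive term absorbs. -/
theorem expectedCost_le [Nonempty Block] [NeZero M] (hα : 1 ≤ α) (hk : 2 ≤ I.k)
    (hM : 2 * I.aspectRatio * I.k ^ 2 * (I.k + 1) ≤ M)
    (hε : Real.exp (1 - α / 2) * (I.k ^ 2 * M * I.aspectRatio) ≤ 1)
    {σ : List Page} {C : ℕ → Finset Page} (hC : I.IsFeasible σ C) :
    (I.roundingAlgorithm M α hα (by omega)).expectedCost σ
      ≤ 48 * α * Real.log I.k * I.cost σ C + ∑ B, I.c B := by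
  have hk1 : 1 ≤ I.k := by omega
  have hM0 : 0 < M := NeZero.pos M
  have hM' : (0 : ℝ) < M := by exact_mod_cast hM0
  have hα' : (1 : ℝ) ≤ α := by exact_mod_cast hα
  have hk' : (2 : ℝ) ≤ I.k := by exact_mod_cast hk
  have hA := shift_pos (I := I) hM0 hα hk1
  have hinf : 0 < ⨅ B', I.c B' := iInf_c_pos
  have hsup : 0 < ⨆ B', I.c B' := iSup_c_pos
  have hcost : 0 ≤ I.cost σ C :=
    Finset.sum_nonneg fun t _ => Finset.sum_nonneg fun B _ => (I.c_pos B).le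
  set F := (∑ B, I.c B * ((I.stateAfter M α σ).level B : ℝ)) / M with hF
  set ε := Real.exp (1 - α / 2) with hεdef
  have hε0 : 0 < ε := Real.exp_pos _
  have hlog : Real.log ((M + 2 * I.shift M α) / I.shift M α) ≤ 2 * Real.log I.k := by
    rw [show 2 * Real.log I.k = Real.log ((I.k : ℝ) ^ 2) by rw [Real.log_pow]; norm_num]
    -- This reduces to `k + 2 ≤ k ^ 2`, which needs `k ≥ 2`.
    refine Real.log_le_log (by positivity) ?_
    have : (M + 2 * I.shift M α) / I.shift M α = I.k / α + 2 := by
      rw [shift]; field_simp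
    rw [this]
    have : (I.k : ℝ) / α ≤ I.k := div_le_self (by linarith) hα'
    nlinarith
  have hFle : F ≤ 24 * α * Real.log I.k * I.cost σ C := by
    rw [hF, div_le_iff₀ hM']
    refine (level_cost_le hM0 hα hk1 hM hC).trans ?_
    calc 12 * α * M * (Real.log ((M + 2 * I.shift M α) / I.shift M α) * I.cost σ C)
        ≤ 12 * α * M * (2 * Real.log I.k * I.cost σ C) := by gcongr
      _ = _ := by ring
  have hlevel : (⨅ B, I.c B) * ∑ B, ((I.stateAfter M α σ).level B : ℝ) ≤ M * F := by
    rw [hF, mul_div_cancel₀ _ hM'.ne', Finset.mul_sum]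
    exact Finset.sum_le_sum fun B _ => mul_le_mul_of_nonneg_right (iInf_le_c B) (by positivity)
  have hact : (I.activeSteps M α σ : ℝ)
      ≤ I.k * M + I.k * ∑ B, ((I.stateAfter M α σ).level B : ℝ) := by
    exact_mod_cast activeSteps_le (I := I) (M := M) hM0 hα hk1 σ
  have hF0 : 0 ≤ F := by
    refine div_nonneg (Finset.sum_nonneg fun B _ => mul_nonneg (I.c_pos B).le ?_) hM'.le
    positivity
  have hΔ : (⨆ B, I.c B) = I.aspectRatio * ⨅ B, I.c B := by
    rw [aspectRatio, div_mul_cancel₀ _ hinf.ne']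
  have hΔ0 : 0 ≤ I.aspectRatio := div_nonneg hsup.le hinf.le
  have hfail : I.activeSteps M α σ * (ε * (I.k * ⨆ B, I.c B)) ≤ (⨅ B, I.c B) + F := by
    calc I.activeSteps M α σ * (ε * (I.k * ⨆ B, I.c B))
        ≤ (I.k * M + I.k * ∑ B, ((I.stateAfter M α σ).level B : ℝ))
            * (ε * (I.k * ⨆ B, I.c B)) := by gcongr
      _ = ε * I.k ^ 2 * I.aspectRatio * (M * (⨅ B, I.c B)
            + (⨅ B, I.c B) * ∑ B, ((I.stateAfter M α σ).level B : ℝ)) := by rw [hΔ]; ring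
      _ ≤ ε * I.k ^ 2 * I.aspectRatio * (M * (⨅ B, I.c B) + M * F) := by gcongr
      _ = ε * (I.k ^ 2 * M * I.aspectRatio) * ((⨅ B, I.c B) + F) := by ring
      _ ≤ 1 * ((⨅ B, I.c B) + F) := by gcongr
      _ = _ := one_mul _
  have hmin : (⨅ B, I.c B) ≤ ∑ B, I.c B :=
    (iInf_le_c (Classical.arbitrary Block)).trans
      (Finset.single_le_sum (fun B _ => (I.c_pos B).le) (Finset.mem_univ _))
  rw [expectedCost_roundingAlgorithm, inv_mul_le_iff₀ (by positivity)]
  refine (sum_cost_cacheOf_le hM0 hα hk1 σ).trans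
    (mul_le_mul_of_nonneg_left ?_ (by positivity))
  linarith

/-! ### Choice of the parameters and degenerate cases -/

theorem one_le_aspectRatio [Nonempty Block] : 1 ≤ I.aspectRatio :=
  (one_le_div iInf_c_pos).2 ((iInf_le_c (Classical.arbitrary Block)).trans (c_le_iSup _))

theorem exists_isFeasible (hk : 1 ≤ I.k) (σ : List Page) : ∃ C, I.IsFeasible σ C := by
  -- The cache holds just the last request; the filter empties it at `t = 0`, where `t - 1`
  -- truncates to 0.
  refine ⟨fun t => (σ[t - 1]?.filter fun _ => decide (0 < t)).toFinset, by simp, fun t _ => ?_,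
    fun t ht => by simp [ht]⟩
  refine le_trans ?_ hk
  rw [Option.card_toFinset]
  generalize Option.filter _ _ = o
  cases o <;> simp

theorem le_mul_opt_add (hk : 1 ≤ I.k) {σ : List Page} {x r b : ℝ} (hr : 0 < r)
    (h : ∀ C, I.IsFeasible σ C → x ≤ r * I.cost σ C + b) : x ≤ r * I.opt σ + b := by
  have h1 : (x - b) / r ≤ I.opt σ := by
    obtain ⟨C₀, hC₀⟩ := exists_isFeasible hk σ
    refine le_csInf ⟨_, C₀, hC₀, rfl⟩ ?_
    rintro _ ⟨C, hC, rfl⟩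
    rw [div_le_iff₀' hr]
    linarith [h C hC]
  rw [div_le_iff₀' hr] at h1
  linarith

theorem exists_isCompetitive [Nonempty Block] (I : BlockCaching Page Block) (hk : 2 ≤ I.k) :
    ∃ A : I.RandomizedOnlineAlgorithm,
      A.IsCompetitive (960 * (Real.log I.k * Real.log (I.k * I.aspectRatio))) (∑ B, I.c B) := by
  have hk' : (2 : ℝ) ≤ I.k := by exact_mod_cast hk
  have hΔ := one_le_aspectRatio (I := I)
  set Δ := I.aspectRatio with hΔdef
  set L := Real.log (I.k * Δ) with hL
  have hkΔ : (2 : ℝ) ≤ I.k * Δ := by nlinarith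
  have hlogk : Real.log 2 ≤ Real.log I.k := Real.log_le_log (by norm_num) hk'
  have hlog2 := Real.log_two_gt_d9
  have hlogL : Real.log 2 ≤ L := Real.log_le_log (by norm_num) hkΔ
  set M := ⌈2 * Δ * I.k ^ 2 * (I.k + 1)⌉₊ with hMdef
  -- Since `k ^ 2 * M * Δ ≤ exp (7 * L)`, the failure exponent is at most `1 - 9 * L + 7 * L`, which
  -- is negative because `L ≥ log 2 > 1 / 2`.
  set α := ⌈18 * L⌉₊ with hαdef
  have hMle : 2 * Δ * I.k ^ 2 * (I.k + 1) ≤ M := Nat.le_ceil _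
  have hMpos : 0 < M := Nat.ceil_pos.2 (by positivity)
  have : NeZero M := ⟨hMpos.ne'⟩
  have hα : 1 ≤ α := Nat.ceil_pos.2 (by linarith)
  have hαge : 18 * L ≤ α := Nat.le_ceil _
  have hαle : (α : ℝ) ≤ 20 * L := by
    have := Nat.ceil_lt_add_one (a := 18 * L) (by linarith)
    linarith
  have hMle' : (M : ℝ) ≤ 4 * Δ * I.k ^ 3 := by
    have h1 := Nat.ceil_lt_add_one (a := 2 * Δ * I.k ^ 2 * (I.k + 1)) (by positivity)
    have h2 : (1 : ℝ) ≤ Δ * I.k ^ 2 := by nlinarith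
    have h3 : Δ * I.k ^ 2 * 2 ≤ Δ * (I.k : ℝ) ^ 2 * I.k :=
      mul_le_mul_of_nonneg_left hk' (by positivity)
    have h4 : 4 * Δ * (I.k : ℝ) ^ 3 = 4 * (Δ * (I.k : ℝ) ^ 2 * I.k) := by ring
    have h5 : 2 * Δ * (I.k : ℝ) ^ 2 * (I.k + 1)
      = 2 * (Δ * (I.k : ℝ) ^ 2 * I.k) + 2 * (Δ * (I.k : ℝ) ^ 2) := by ring
    rw [h4]
    linarith
  have hε : Real.exp (1 - α / 2) * (I.k ^ 2 * M * Δ) ≤ 1 := by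
    have h1 : (I.k : ℝ) ^ 2 * M * Δ ≤ (I.k * Δ) ^ 7 := by
      calc (I.k : ℝ) ^ 2 * M * Δ ≤ I.k ^ 2 * (4 * Δ * I.k ^ 3) * Δ := by gcongr
        _ = 2 ^ 2 * (I.k ^ 5 * Δ ^ 2) := by ring
        _ ≤ I.k ^ 2 * (I.k ^ 5 * Δ ^ 7) := by gcongr; norm_num
        _ = _ := by ring
    have h2 : ((I.k : ℝ) * Δ) ^ 7 = Real.exp (7 * L) := by
      have h := Real.exp_nat_mul L 7
      rw [hL, Real.exp_log (by linarith)] at h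
      exact_mod_cast h.symm
    calc Real.exp (1 - α / 2) * (I.k ^ 2 * M * Δ)
        ≤ Real.exp (1 - α / 2) * Real.exp (7 * L) := by rw [← h2]; gcongr
      _ = Real.exp (1 - α / 2 + 7 * L) := (Real.exp_add _ _).symm
      _ ≤ 1 := Real.exp_le_one_iff.2 (by linarith)
  refine ⟨I.roundingAlgorithm M α hα (by omega), fun σ => ?_⟩
  have hlk : 0 < Real.log I.k := by linarith
  refine le_mul_opt_add (by omega) (mul_pos (by norm_num) (mul_pos hlk (by linarith)))
    fun C hC => ?_
  have hcost : 0 ≤ I.cost σ C :=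
    Finset.sum_nonneg fun t _ => Finset.sum_nonneg fun B _ => (I.c_pos B).le
  refine (expectedCost_le hα hk hMle hε hC).trans (add_le_add_left ?_ _)
  calc 48 * α * Real.log I.k * I.cost σ C ≤ 48 * (20 * L) * Real.log I.k * I.cost σ C := by gcongr
    _ = _ := by ring

theorem aspectRatio_eq_one [Nonempty Block] (h : ∀ B B', I.c B = I.c B') : I.aspectRatio = 1 := by
  have h1 : I.c = fun _ => I.c (Classical.arbitrary Block) := funext fun B => h _ _
  have h2 := I.c_pos (Classical.arbitrary Block)
  rw [aspectRatio, h1, ciSup_const, ciInf_const, div_self h2.ne']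

/-- The algorithm for an instance without pages. -/
noncomputable def trivialAlgorithm [IsEmpty Page] (I : BlockCaching Page Block) :
    I.RandomizedOnlineAlgorithm where
  Ω := Unit
  μ := MeasureTheory.Measure.dirac ()
  cache _ _ := ∅
  measurableSet_cache _ _ := MeasurableSet.const _
  cache_nil _ := rfl
  card_cache_le _ _ := Nat.zero_le _
  mem_cache _ _ p := isEmptyElim p

theorem isCompetitive_trivialAlgorithm [IsEmpty Page] [IsEmpty Block] (r : ℝ) :
    (I.trivialAlgorithm).IsCompetitive r (∑ B, I.c B) := by
  intro σ
  obtain rfl : σ = [] := List.eq_nil_iff_forall_not_mem.2 fun p => isEmptyElim p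
  have h : I.opt [] = 0 := by
    have : {x | ∃ C : ℕ → Finset Page, I.IsFeasible [] C ∧ I.cost [] C = x} = {0} := by
      ext x
      constructor
      · rintro ⟨C, -, rfl⟩; simp [cost]
      · rintro rfl
        exact ⟨fun _ => ∅, ⟨rfl, by simp, by simp⟩, by simp [cost]⟩
    rw [opt, this, csInf_singleton]
  simp [RandomizedOnlineAlgorithm.expectedCost, cost, h]

end BlockCaching

theorem mainTheorem3 :
    ∃ K : ℝ, 0 < K ∧
      ∀ (Page Block : Type) [Fintype Page] [DecidableEq Page] [Fintype Block] [DecidableEq Block]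
        (I : BlockCaching Page Block), 2 ≤ I.k →
        ∃ A : I.RandomizedOnlineAlgorithm,
          A.IsCompetitive (K * (Real.log I.k * Real.log (I.k * I.aspectRatio))) (∑ B, I.c B) ∧
          ((∀ B B' : Block, I.c B = I.c B') →
            A.IsCompetitive (K * Real.log I.k ^ 2) (∑ B, I.c B)) := by
  -- This is `48 * 20`, from `α ≤ 20 * L`.
  refine ⟨960, by norm_num, ?_⟩
  intro Page Block _ _ _ _ I hk
  -- Without blocks the supremum and infimum of the costs are default values, but only the empty
  -- request sequence exists.
  rcases isEmpty_or_nonempty Block with hB | hB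
  · have : IsEmpty Page := ⟨fun p => hB.false (I.block p)⟩
    exact ⟨I.trivialAlgorithm, BlockCaching.isCompetitive_trivialAlgorithm _,
      fun _ => BlockCaching.isCompetitive_trivialAlgorithm _⟩
  · obtain ⟨A, hA⟩ := BlockCaching.exists_isCompetitive I hk
    refine ⟨A, hA, fun h => ?_⟩
    rwa [BlockCaching.aspectRatio_eq_one h, mul_one, ← sq] at hA
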